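/- Let $d\ge 0$ and $N\ge 1$ be integers, let $x_1,\dots,x_N\in\mathcal X$, let $t>0$, and let $f:\mathcal X\times\mathbb R^d\to[\widetilde F_{\min},\widetilde F_{\max}]$ be such that $\theta\mapsto f(x;\theta)$ is $L$-Lipschitz (Euclidean norm, $L\ge 0$) for every $x\in\mathcal X$, and differentiable for every $x=x_i$, $i\in[N]$. Put $\Delta:=\widetilde F_{\max}-\widetilde F_{\min}$ and, for nonempty $S\subseteq[N]$, $$\widetilde R_S(t;\theta):=\frac1t\log\Big(\frac1{|S|}\sum_{i\in S}e^{tf(x_i;\theta)}\Big),\qquad \widetilde R(t;\theta):=\widetilde R_{[N]}(t;\theta).$$ Assume that $\widetilde R(t;\cdot)$ is $\beta$-smooth for some $\beta>0$ (i.e. $\nabla_\theta\widetilde R(t;\cdot)$ is $\beta$-Lipschitz on $\mathbb R^d$; no convexity is assumed), and that the stochastic gradients are uniformly bounded by some $B>0$: $$\Big\|\frac{e^{tf(x_i;\theta)}}{e^{t\widetilde R(t;\theta)}}\nabla_\theta f(x_i;\theta)\Big\|\le B\qquad(\theta\in\mathbb R^d,\ i\in[N]).$$ Let $$k_t:=\Big\lceil\frac{2\Delta\,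 t^2L^2}{\beta e^2}\Big\rceil,\qquad \lambda:=1-\frac1{2e},$$ let $K\ge\max\{k_t,1\}$, and let $$\alpha_k:=\frac1{tLBe^{t\Delta}+1}\ \text{ for } k<k_t,\qquad \alpha_k:=\frac{\sqrt{2\Delta}}{e^{t\Delta}\sqrt{\beta B^2K}}\ \text{ for } k\ge k_t.$$ Consider the stochastic TERM solver with two independent minibatches of size $1$: start from any $\theta_1\in\mathbb R^d$ and $\rho_0:=\widetilde R(t;\theta_1)$; in iteration $k=1,2,\dots$ draw indices $\zeta_k,\xi_k$ uniformly from $[N]$, all draws $(\zeta_k)_k,(\xi_k)_k$ being mutually independent, and set $$\rho_k:=\frac1t\log\Big((1-\lambda)e^{t\rho_{k-1}}+\lambda e^{t\widetilde R_{\{\xi_k\}}(t;\theta_k)}\Big),\qquad \theta_{k+1}:=\theta_k-\alpha_k\,e^{tf(x_{\zeta_k};\theta_k)-t\rho_k}\,\nabla_\theta f(x_{\zeta_k};\theta_k).$$ Then $$\frac1K\sum_{k=k_t}^{K}\mathbb E\big[\|\nabla_\theta\widetilde R(t;\theta_k)\|^2\big]\ \le\ \sqrt8\,B\,e^{t\Delta+1}\sqrt{\frac{\beta\Delta}{K}},$$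 where $\theta_0:=\theta_1$ (this is relevant only if $k_t=0$, i.e. if $\Delta=0$ or $L=0$, when all gradients vanish). -/

import Mathlib

open MeasureTheory ProbabilityTheory
open scoped NNReal ENNReal

noncomputable section

namespace TERM

/-- Parameter space `ℝ^d` with the Euclidean norm. -/
abbrev Param (d : ℕ) : Type := EuclideanSpace ℝ (Fin d)

variable {𝒳 : Type*} {N d : ℕ}

/-- The `t`-tilted loss over the samples indexed by `S ⊆ [N]`,
`(1/t) log ((1/|S|) ∑_{i ∈ S} exp (t f(x_i; θ)))`. -/
def tiltedLossOn (f : 𝒳 → Param d → ℝ) (x : Fin N → 𝒳) (t : ℝ) (S : Finset (Fin N))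
    (θ : Param d) : ℝ :=
  (1 / t) * Real.log ((1 / (S.card : ℝ)) * ∑ i ∈ S, Real.exp (t * f (x i) θ))

/-- The TERM objective `R̃(t; θ)`: the `t`-tilted loss over all `N` samples. -/
def tiltedLoss (f : 𝒳 → Param d → ℝ) (x : Fin N → 𝒳) (t : ℝ) (θ : Param d) : ℝ :=
  tiltedLossOn f x t Finset.univ θ

/-- The tilted stochastic gradient at sample `i`,
`(exp (t f(x_i; θ)) / exp (t R̃(t; θ))) ∇f(x_i; θ)`. -/
def stochGrad (f : 𝒳 → Param d → ℝ) (x : Fin N → 𝒳) (t : ℝ) (i : Fin N)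
    (θ : Param d) : Param d :=
  (Real.exp (t * f (x i) θ) / Real.exp (t * tiltedLoss f x t θ)) • gradient (f (x i)) θ

/-- The update of the running estimate of the tilted objective with the minibatch `B₂`:
`(1/t) log ((1-lam) exp (t R) + lam exp (t R̃_{B₂}))`. -/
def estimateUpdate (f : 𝒳 → Param d → ℝ) (x : Fin N → 𝒳) (t lam : ℝ) (B₂ : Finset (Fin N))
    (θ : Param d) (R : ℝ) : ℝ :=
  (1 / t) * Real.log ((1 - lam) * Real.exp (t * R)
    + lam * Real.exp (t * tiltedLossOn f x t B₂ θ))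

/-- The update of the parameter with the minibatch `B₁`, the step size `α` and the current
estimate `R` of the tilted objective:
`θ - (α/|B₁|) ∑_{i ∈ B₁} exp (t f(x_i; θ) - t R) ∇f(x_i; θ)`. -/
def paramUpdate (f : 𝒳 → Param d → ℝ) (x : Fin N → 𝒳) (t α : ℝ) (B₁ : Finset (Fin N))
    (θ : Param d) (R : ℝ) : Param d :=
  θ - (α / (B₁.card : ℝ)) •
    ∑ i ∈ B₁, Real.exp (t * f (x i) θ - t * R) • gradient (f (x i)) θ

/-- One iteration of the two-minibatch stochastic TERM solver on the pair
(parameter, estimate of the tilted objective): the estimate is refreshed with `B₂` first,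
then the parameter moves along the gradients on `B₁`, weighted with the refreshed estimate. -/
def iteration (f : 𝒳 → Param d → ℝ) (x : Fin N → 𝒳) (t lam α : ℝ) (B₁ B₂ : Finset (Fin N))
    (s : Param d × ℝ) : Param d × ℝ :=
  (paramUpdate f x t α B₁ s.1 (estimateUpdate f x t lam B₂ s.1 s.2),
    estimateUpdate f x t lam B₂ s.1 s.2)

/-- The state after `n` iterations, started at `θ₁` with the exact estimate `R̃(t; θ₁)`.
Iterations are numbered `1, 2, …`; iteration `k` uses the step size `α k` and the
minibatches `B₁ k`, `B₂ k`. -/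
def state (f : 𝒳 → Param d → ℝ) (x : Fin N → 𝒳) (t lam : ℝ) (α : ℕ → ℝ)
    (B₁ B₂ : ℕ → Finset (Fin N)) (θ₁ : Param d) : ℕ → Param d × ℝ
  | 0 => (θ₁, tiltedLoss f x t θ₁)
  | n + 1 => iteration f x t lam (α (n + 1)) (B₁ (n + 1)) (B₂ (n + 1))
      (state f x t lam α B₁ B₂ θ₁ n)

/-- The iterate `θ_k`, `k ≥ 1`: the parameter at the start of iteration `k`, that is, after
`k - 1` iterations (with the convention `θ_0 = θ_1`). -/
def iterate (f : 𝒳 → Param d → ℝ) (x : Fin N → 𝒳) (t lam : ℝ) (α : ℕ → ℝ)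
    (B₁ B₂ : ℕ → Finset (Fin N)) (θ₁ : Param d) (k : ℕ) : Param d :=
  (state f x t lam α B₁ B₂ θ₁ (k - 1)).1

/-- The averaging weight `1 - 1/(2e)`. -/
def averagingWeight : ℝ := 1 - 1 / (2 * Real.exp 1)

/-- The burn-in `k_t = ⌈2 (Fmax - Fmin) t² L² / (β e²)⌉`. -/
def burnIn (t L β Fmin Fmax : ℝ) : ℕ :=
  ⌈2 * (Fmax - Fmin) * t ^ 2 * L ^ 2 / (β * Real.exp 1 ^ 2)⌉₊

/-- The step sizes for the horizon `K`: a fixed one before the burn-in, and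
`√(2 (Fmax - Fmin)) / (exp (t (Fmax - Fmin)) √(β B² K))` from the burn-in on. -/
def stepSize (t L β B Fmin Fmax : ℝ) (K k : ℕ) : ℝ :=
  if k < burnIn t L β Fmin Fmax then
    1 / (t * L * B * Real.exp (t * (Fmax - Fmin)) + 1)
  else
    Real.sqrt (2 * (Fmax - Fmin)) /
      (Real.exp (t * (Fmax - Fmin)) * Real.sqrt (β * B ^ 2 * K))

end TERM

end

/-!
Along the iteration the potential `R̃ θ + α/(4e) · exp (t (ρ - R̃ θ)) · ‖∇R̃ θ‖²` decreases on
average by `α/2 · ‖∇R̃ θ‖²`, up to an error of second order in the step size `α`. Write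
`z = exp (t (ρ - R̃ θ))` with the refreshed estimate `ρ`. A step moves `θ` by `α / z` times an
unbiased estimator of `∇R̃ θ`, so the objective gains `α/z · ‖∇R̃ θ‖² ≥ α (1 - z/4) ‖∇R̃ θ‖²`, and
since `z` grows at most by the factor `e` while `θ` moves, the new correction term costs at most
another `α z/4 · ‖∇R̃ θ‖²`. The total loss `α z/2 · ‖∇R̃ θ‖²` is affordable because refreshing the
estimate replaces `z`, on average, by `z/(2e) + 1 - 1/(2e)`.

Telescoping with the balanced step size gives the rate once `√K ≥ exp (tΔ + 1)`, which is what
keeps the growth factor below `e`. For smaller `K` the bound is already implied by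
`‖∇R̃‖² ≤ B √(2βΔ)`, because a smooth function with range of length `Δ` has gradient at most
`√(2βΔ)`.
-/

open scoped BigOperators

namespace TERM

section SmoothFunction

variable {E : Type*} [NormedAddCommGroup E] [InnerProductSpace ℝ E] [CompleteSpace E]
  {R : E → ℝ} {β : ℝ≥0}

theorem le_add_inner_gradient_add_sq (hR : Differentiable ℝ R)
    (hβ : LipschitzWith β (gradient R)) (y v : E) :
    R (y + v) ≤ R y + inner ℝ (gradient R y) v + β / 2 * ‖v‖ ^ 2 := by
  let φ : ℝ → ℝ := fun s =>
    R (y + s • v) - (s * inner ℝ (gradient R y) v + s ^ 2 * (β / 2 * ‖v‖ ^ 2))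
  have hφ : ∀ s, HasDerivAt φ (inner ℝ (gradient R (y + s • v) - gradient R y) v
      - s * (β * ‖v‖ ^ 2)) s := fun s => by
    have hline : HasDerivAt (fun s : ℝ => y + s • v) v s := by
      simpa using ((hasDerivAt_id s).smul_const v).const_add y
    have hpoly := ((hasDerivAt_id s).mul_const (inner ℝ (gradient R y) v)).add
      ((hasDerivAt_pow 2 s).mul_const (β / 2 * ‖v‖ ^ 2))
    refine (((hR _).hasGradientAt.hasFDerivAt.comp_hasDerivAt s hline).sub hpoly).congr_deriv ?_
    rw [inner_sub_left, InnerProductSpace.toDual_apply_apply]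
    norm_num
    ring
  have hφ_nonpos : ∀ s ∈ interior (Set.Icc (0 : ℝ) 1), deriv φ s ≤ 0 := fun s hs => by
    rw [interior_Icc] at hs
    rw [(hφ s).deriv, sub_nonpos]
    calc inner ℝ (gradient R (y + s • v) - gradient R y) v
        ≤ ‖gradient R (y + s • v) - gradient R y‖ * ‖v‖ := real_inner_le_norm _ _
      _ ≤ β * ‖y + s • v - y‖ * ‖v‖ := by gcongr; exact hβ.norm_sub_le _ _
      _ = s * (β * ‖v‖ ^ 2) := by
          rw [add_sub_cancel_left, norm_smul, Real.norm_of_nonneg hs.1.le]; ring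
  have hanti : AntitoneOn φ (Set.Icc 0 1) :=
    antitoneOn_of_deriv_nonpos (convex_Icc 0 1)
      (fun s _ => (hφ s).continuousAt.continuousWithinAt)
      (fun s _ => (hφ s).differentiableAt.differentiableWithinAt) hφ_nonpos
  have h01 : φ 1 ≤ φ 0 := hanti (by simp) (by simp) zero_le_one
  simp only [φ, one_smul, zero_smul, add_zero] at h01
  linarith

theorem norm_gradient_sq_le_of_mem_Icc (hR : Differentiable ℝ R)
    (hβ : LipschitzWith β (gradient R)) (hβ0 : 0 < β) {a b : ℝ} (hab : ∀ y, R y ∈ Set.Icc a b)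
    (y : E) : ‖gradient R y‖ ^ 2 ≤ 2 * β * (b - a) := by
  have hβ0' : (0 : ℝ) < β := hβ0
  have hstep := le_add_inner_gradient_add_sq hR hβ y (-(β : ℝ)⁻¹ • gradient R y)
  rw [real_inner_smul_right, real_inner_self_eq_norm_sq, norm_smul, norm_neg, norm_inv,
    Real.norm_of_nonneg hβ0'.le] at hstep
  have hdecrease : ‖gradient R y‖ ^ 2 / (2 * β) ≤ b - a := by
    have hquad : -(β : ℝ)⁻¹ * ‖gradient R y‖ ^ 2 + β / 2 * ((β : ℝ)⁻¹ * ‖gradient R y‖) ^ 2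
        = -(‖gradient R y‖ ^ 2 / (2 * β)) := by
      field_simp
      ring
    linarith [(hab (y + -(β : ℝ)⁻¹ • gradient R y)).1, (hab y).2]
  rwa [div_le_iff₀' (by positivity)] at hdecrease

theorem sub_le_mul_norm_sub_of_norm_gradient_le (hR : Differentiable ℝ R) {C : ℝ}
    (hC : ∀ y, ‖gradient R y‖ ≤ C) (y z : E) : R y - R z ≤ C * ‖y - z‖ :=
  (le_abs_self _).trans <| convex_univ.norm_image_sub_le_of_norm_fderiv_le (𝕜 := ℝ)
    (fun w _ => hR w)
    (fun w _ => by simpa only [gradient, LinearIsometryEquiv.norm_map] using hC w)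
    (Set.mem_univ z) (Set.mem_univ y)

theorem norm_gradient_sq_le_add_mul_norm_sub (hβ : LipschitzWith β (gradient R)) {B : ℝ}
    (hB : ∀ y, ‖gradient R y‖ ≤ B) (y z : E) :
    ‖gradient R z‖ ^ 2 ≤ ‖gradient R y‖ ^ 2 + 2 * B * (β * ‖z - y‖) := by
  have hdiff : ‖gradient R z‖ - ‖gradient R y‖ ≤ β * ‖z - y‖ :=
    (norm_sub_norm_le _ _).trans (hβ.norm_sub_le z y)
  have hsum : ‖gradient R z‖ + ‖gradient R y‖ ≤ 2 * B := by linarith [hB y, hB z]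
  calc ‖gradient R z‖ ^ 2
      = ‖gradient R y‖ ^ 2
        + (‖gradient R z‖ + ‖gradient R y‖) * (‖gradient R z‖ - ‖gradient R y‖) := by ring
    _ ≤ ‖gradient R y‖ ^ 2 + (‖gradient R z‖ + ‖gradient R y‖) * (β * ‖z - y‖) := by gcongr
    _ ≤ ‖gradient R y‖ ^ 2 + 2 * B * (β * ‖z - y‖) := by gcongr

end SmoothFunction

section Potential

variable {E : Type*} [NormedAddCommGroup E] [InnerProductSpace ℝ E] [CompleteSpace E]
  {R : E → ℝ} {β : ℝ≥0} {t α B D ρ lam : ℝ} {θ h : E}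

/-- The Lyapunov function of a descent on `R` whose steps are divided by an estimate `exp (t ρ)`
of `exp (t R)`: the objective plus a multiple of its squared gradient, weighted with the relative
error of the estimate. A state is a pair `(θ, ρ)`. -/
noncomputable def potential (R : E → ℝ) (t α : ℝ) (s : E × ℝ) : ℝ :=
  R s.1 + α / (4 * Real.exp 1) * (Real.exp (t * (s.2 - R s.1)) * ‖gradient R s.1‖ ^ 2)

theorem le_potential (hα : 0 ≤ α) (s : E × ℝ) : R s.1 ≤ potential R t α s :=
  le_add_of_nonneg_right (by positivity)

theorem potential_le {M C : ℝ} (ht : 0 ≤ t) (hα : 0 ≤ α) {s : E × ℝ} (hM : R s.1 ≤ M)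
    (hD : s.2 - R s.1 ≤ D) (hC : ‖gradient R s.1‖ ^ 2 ≤ C) :
    potential R t α s ≤ M + α / (4 * Real.exp 1) * (Real.exp (t * D) * C) := by
  unfold potential
  gcongr

/-- The estimate `ρ` is built before the move from `θ`, so the step length is at most
`α B exp (t (R θ - ρ))`, and this factor cancels against the weight of the potential. -/
theorem exp_mul_norm_gradient_sq_step_le (hβ : LipschitzWith β (gradient R))
    (hB : ∀ y, ‖gradient R y‖ ≤ B) (hα : 0 ≤ α) (hh : ‖h‖ ≤ B)
    (hstep : t * (R θ - R (θ - (α * Real.exp (t * (R θ - ρ))) • h)) ≤ 1) :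
    Real.exp (t * (ρ - R (θ - (α * Real.exp (t * (R θ - ρ))) • h)))
        * ‖gradient R (θ - (α * Real.exp (t * (R θ - ρ))) • h)‖ ^ 2
      ≤ Real.exp 1 * (Real.exp (t * (ρ - R θ)) * ‖gradient R θ‖ ^ 2 + 2 * β * α * B ^ 2) := by
  set w := Real.exp (t * (R θ - ρ)) with hw
  set θ' := θ - (α * w) • h with hθ'
  have hB0 : 0 ≤ B := (norm_nonneg h).trans hh
  have hcancel : Real.exp (t * (ρ - R θ)) * w = 1 := by
    rw [hw, ← Real.exp_add, Real.exp_eq_one_iff]; ring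
  have hweight : Real.exp (t * (ρ - R θ')) ≤ Real.exp 1 * Real.exp (t * (ρ - R θ)) := by
    rw [← Real.exp_add]
    gcongr
    linarith
  have hlength : ‖θ' - θ‖ ≤ α * w * B := by
    rw [hθ', sub_sub_cancel_left, norm_neg, norm_smul, Real.norm_of_nonneg (by positivity)]
    gcongr
  calc Real.exp (t * (ρ - R θ')) * ‖gradient R θ'‖ ^ 2
      ≤ Real.exp 1 * Real.exp (t * (ρ - R θ))
          * (‖gradient R θ‖ ^ 2 + 2 * B * (β * (α * w * B))) := by
        gcongr
        exact (norm_gradient_sq_le_add_mul_norm_sub hβ hB θ θ').trans (by gcongr)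
    _ = Real.exp 1 * (Real.exp (t * (ρ - R θ)) * ‖gradient R θ‖ ^ 2
          + 2 * β * α * B ^ 2 * (Real.exp (t * (ρ - R θ)) * w)) := by ring
    _ = _ := by rw [hcancel, mul_one]

theorem potential_step_le (hR : Differentiable ℝ R) (hβ : LipschitzWith β (gradient R))
    (hB : ∀ y, ‖gradient R y‖ ≤ B) (ht : 0 ≤ t) (hα : 0 ≤ α) (hh : ‖h‖ ≤ B) (hD0 : 0 ≤ D)
    (hD : R θ - ρ ≤ D)
    (hstep : t * (R θ - R (θ - (α * Real.exp (t * (R θ - ρ))) • h)) ≤ 1) :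
    potential R t α (θ - (α * Real.exp (t * (R θ - ρ))) • h, ρ)
      ≤ R θ - α * Real.exp (t * (R θ - ρ)) * inner ℝ (gradient R θ) h
        + α / 4 * Real.exp (t * (ρ - R θ)) * ‖gradient R θ‖ ^ 2
        + β * (α * B * Real.exp (t * D)) ^ 2 := by
  have hweighted := exp_mul_norm_gradient_sq_step_le hβ hB hα hh hstep
  set w := Real.exp (t * (R θ - ρ)) with hw
  have hB0 : 0 ≤ B := (norm_nonneg h).trans hh
  have hwD : w ≤ Real.exp (t * D) := by rw [hw]; gcongr
  have hD1 : 1 ≤ Real.exp (t * D) := Real.one_le_exp (by positivity)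
  have hobjective : R (θ - (α * w) • h)
      ≤ R θ - α * w * inner ℝ (gradient R θ) h + β / 2 * (α * B * Real.exp (t * D)) ^ 2 := by
    have hdescent := le_add_inner_gradient_add_sq hR hβ θ (-((α * w) • h))
    rw [← sub_eq_add_neg, inner_neg_right, real_inner_smul_right, norm_neg, norm_smul,
      Real.norm_of_nonneg (by positivity)] at hdescent
    have hlength : α * w * ‖h‖ ≤ α * B * Real.exp (t * D) := by
      calc α * w * ‖h‖ ≤ α * Real.exp (t * D) * B := by gcongr
        _ = _ := by ring
    have hsq : (β : ℝ) / 2 * (α * w * ‖h‖) ^ 2 ≤ β / 2 * (α * B * Real.exp (t * D)) ^ 2 := by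
      gcongr
    linarith
  have hcorrection := mul_le_mul_of_nonneg_left hweighted
    (show 0 ≤ α / (4 * Real.exp 1) by positivity)
  have hexpand : α / (4 * Real.exp 1) * (Real.exp 1
        * (Real.exp (t * (ρ - R θ)) * ‖gradient R θ‖ ^ 2 + 2 * β * α * B ^ 2))
      = α / 4 * Real.exp (t * (ρ - R θ)) * ‖gradient R θ‖ ^ 2 + β / 2 * (α * B) ^ 2 := by
    field_simp
    ring
  have herror : (β : ℝ) / 2 * (α * B) ^ 2 ≤ β / 2 * (α * B * Real.exp (t * D)) ^ 2 := by
    have hscale : α * B ≤ α * B * Real.exp (t * D) :=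
      le_mul_of_one_le_right (by positivity) hD1
    gcongr
  simp only [potential]
  linarith

variable {ι κ : Type*} [Fintype ι] [Nonempty ι] [Fintype κ] [Nonempty κ]

theorem expect_potential_step_le {v : ι → E} (hR : Differentiable ℝ R)
    (hβ : LipschitzWith β (gradient R)) (hB : ∀ y, ‖gradient R y‖ ≤ B) (ht : 0 ≤ t) (hα : 0 ≤ α)
    (hv : ∀ i, ‖v i‖ ≤ B) (hmean : 𝔼 i, inner ℝ (gradient R θ) (v i) = ‖gradient R θ‖ ^ 2)
    (hD0 : 0 ≤ D) (hD : R θ - ρ ≤ D)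
    (hstep : ∀ i, t * (R θ - R (θ - (α * Real.exp (t * (R θ - ρ))) • v i)) ≤ 1) :
    𝔼 i, potential R t α (θ - (α * Real.exp (t * (R θ - ρ))) • v i, ρ)
      ≤ R θ - α * ‖gradient R θ‖ ^ 2
        + α / 2 * ‖gradient R θ‖ ^ 2 * Real.exp (t * (ρ - R θ))
        + β * (α * B * Real.exp (t * D)) ^ 2 := by
  set z := Real.exp (t * (ρ - R θ)) with hz
  have hz0 : 0 < z := Real.exp_pos _
  have hinv : Real.exp (t * (R θ - ρ)) = z⁻¹ := by
    rw [hz, ← Real.exp_neg, ← mul_neg, neg_sub]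
  have htangent : 1 - z / 4 ≤ z⁻¹ := by
    rw [← one_div, le_div_iff₀ hz0]
    nlinarith [sq_nonneg (z - 2)]
  have hgain := mul_le_mul_of_nonneg_left htangent
    (show 0 ≤ α * ‖gradient R θ‖ ^ 2 by positivity)
  refine (Finset.expect_le_expect fun i _ =>
    potential_step_le hR hβ hB ht hα (hv i) hD0 hD (hstep i)).trans ?_
  simp only [Finset.expect_add_distrib, Finset.expect_sub_distrib, ← Finset.mul_expect,
    Fintype.expect_const, hmean, hinv, ← hz]
  linarith

/-- The weight `exp (t (ρ - R θ))` is averaged with weight `1 - lam ≤ 1/(2e)`, which beats the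
factor `e` by which it may grow in a step. -/
theorem expect_expect_potential_step_le {v : ι → E} {σ : κ → ℝ} (hR : Differentiable ℝ R)
    (hβ : LipschitzWith β (gradient R)) (hB : ∀ y, ‖gradient R y‖ ≤ B) (ht : 0 ≤ t) (hα : 0 ≤ α)
    (hv : ∀ i, ‖v i‖ ≤ B) (hmean : 𝔼 i, inner ℝ (gradient R θ) (v i) = ‖gradient R θ‖ ^ 2)
    (hlam : averagingWeight ≤ lam) (hlam1 : lam ≤ 1)
    (hσ : 𝔼 j, Real.exp (t * (σ j - R θ)) = (1 - lam) * Real.exp (t * (ρ - R θ)) + lam)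
    (hD0 : 0 ≤ D) (hD : ∀ j, R θ - σ j ≤ D)
    (hstep : ∀ i j, t * (R θ - R (θ - (α * Real.exp (t * (R θ - σ j))) • v i)) ≤ 1) :
    𝔼 j, 𝔼 i, potential R t α (θ - (α * Real.exp (t * (R θ - σ j))) • v i, σ j)
      ≤ potential R t α (θ, ρ) - α / 2 * ‖gradient R θ‖ ^ 2
        + β * (α * B * Real.exp (t * D)) ^ 2 := by
  refine (Finset.expect_le_expect fun j _ => expect_potential_step_le hR hβ hB ht hα hv hmean
    hD0 (hD j) (fun i => hstep i j)).trans ?_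
  simp only [Finset.expect_add_distrib, ← Finset.mul_expect, Fintype.expect_const, hσ]
  have hlam' : 1 - lam ≤ 1 / (2 * Real.exp 1) := by rw [averagingWeight] at hlam; linarith
  have hcontract : (1 - lam) * Real.exp (t * (ρ - R θ)) + lam
      ≤ 1 / (2 * Real.exp 1) * Real.exp (t * (ρ - R θ)) + 1 := by gcongr
  have hscaled := mul_le_mul_of_nonneg_left hcontract
    (show 0 ≤ α / 2 * ‖gradient R θ‖ ^ 2 by positivity)
  have hexpand : α / 2 * ‖gradient R θ‖ ^ 2
        * (1 / (2 * Real.exp 1) * Real.exp (t * (ρ - R θ)) + 1)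
      = α / (4 * Real.exp 1) * (Real.exp (t * (ρ - R θ)) * ‖gradient R θ‖ ^ 2)
        + α / 2 * ‖gradient R θ‖ ^ 2 := by
    field_simp
    ring
  simp only [potential]
  linarith

end Potential

section TiltedLoss

variable {𝒳 : Type*} {N d : ℕ} {f : 𝒳 → Param d → ℝ} {x : Fin N → 𝒳} {S : Finset (Fin N)}
  {θ : Param d} {t lam B Fmin Fmax ρ : ℝ}

theorem exp_mul_mem_Icc_iff {a b u : ℝ} (ht : 0 < t) :
    Real.exp (t * u) ∈ Set.Icc (Real.exp (t * a)) (Real.exp (t * b)) ↔ u ∈ Set.Icc a b := by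
  simp only [Set.mem_Icc, Real.exp_le_exp, mul_le_mul_iff_right₀ ht]

theorem exp_mul_tiltedLossOn (ht : t ≠ 0) (hS : S.Nonempty) :
    Real.exp (t * tiltedLossOn f x t S θ) = 𝔼 i ∈ S, Real.exp (t * f (x i) θ) := by
  have hmean : 1 / (S.card : ℝ) * ∑ i ∈ S, Real.exp (t * f (x i) θ)
      = 𝔼 i ∈ S, Real.exp (t * f (x i) θ) := by
    rw [Finset.expect_eq_sum_div_card]; ring
  rw [tiltedLossOn, ← mul_assoc, mul_one_div_cancel ht, one_mul, hmean,
    Real.exp_log (Finset.expect_pos (fun _ _ => Real.exp_pos _) hS)]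

theorem tiltedLossOn_singleton (ht : t ≠ 0) (j : Fin N) :
    tiltedLossOn f x t {j} θ = f (x j) θ := by
  simp [tiltedLossOn, ht]

theorem tiltedLossOn_mem_Icc (ht : 0 < t) (hS : S.Nonempty)
    (hbdd : ∀ i ∈ S, f (x i) θ ∈ Set.Icc Fmin Fmax) :
    tiltedLossOn f x t S θ ∈ Set.Icc Fmin Fmax := by
  rw [← exp_mul_mem_Icc_iff ht, exp_mul_tiltedLossOn ht.ne' hS]
  exact ⟨Finset.le_expect hS fun i hi => ((exp_mul_mem_Icc_iff ht).2 (hbdd i hi)).1,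
    Finset.expect_le hS fun i hi => ((exp_mul_mem_Icc_iff ht).2 (hbdd i hi)).2⟩

theorem exp_mul_estimateUpdate (ht : t ≠ 0) (h0 : 0 ≤ lam) (h1 : lam ≤ 1) :
    Real.exp (t * estimateUpdate f x t lam S θ ρ)
      = (1 - lam) * Real.exp (t * ρ) + lam * Real.exp (t * tiltedLossOn f x t S θ) := by
  have hpos : 0 < (1 - lam) * Real.exp (t * ρ) + lam * Real.exp (t * tiltedLossOn f x t S θ) :=
    convex_Ioi (0 : ℝ) (Real.exp_pos _) (Real.exp_pos _) (sub_nonneg.2 h1) h0 (sub_add_cancel 1 lam)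
  rw [estimateUpdate, ← mul_assoc, mul_one_div_cancel ht, one_mul, Real.exp_log hpos]

theorem estimateUpdate_mem_Icc (ht : 0 < t) (h0 : 0 ≤ lam) (h1 : lam ≤ 1)
    (hS : tiltedLossOn f x t S θ ∈ Set.Icc Fmin Fmax) (hρ : ρ ∈ Set.Icc Fmin Fmax) :
    estimateUpdate f x t lam S θ ρ ∈ Set.Icc Fmin Fmax := by
  rw [← exp_mul_mem_Icc_iff ht] at hS hρ ⊢
  rw [exp_mul_estimateUpdate ht.ne' h0 h1]
  exact convex_Icc _ _ hρ hS (sub_nonneg.2 h1) h0 (sub_add_cancel 1 lam)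

theorem paramUpdate_singleton (α : ℝ) (i : Fin N) :
    paramUpdate f x t α {i} θ ρ
      = θ - (α * Real.exp (t * (tiltedLoss f x t θ - ρ))) • stochGrad f x t i θ := by
  rw [paramUpdate, stochGrad, Finset.card_singleton, Finset.sum_singleton, Nat.cast_one, div_one,
    ← Real.exp_sub, smul_smul, smul_smul, mul_assoc α, ← Real.exp_add]
  ring_nf

variable [NeZero N]

theorem exp_mul_tiltedLoss (ht : t ≠ 0) :
    Real.exp (t * tiltedLoss f x t θ) = 𝔼 i, Real.exp (t * f (x i) θ) :=
  exp_mul_tiltedLossOn ht Finset.univ_nonempty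

theorem tiltedLoss_mem_Icc (ht : 0 < t) (hbdd : ∀ i, f (x i) θ ∈ Set.Icc Fmin Fmax) :
    tiltedLoss f x t θ ∈ Set.Icc Fmin Fmax :=
  tiltedLossOn_mem_Icc ht Finset.univ_nonempty fun i _ => hbdd i

theorem hasGradientAt_tiltedLoss (ht : t ≠ 0) (hdiff : ∀ i, DifferentiableAt ℝ (f (x i)) θ) :
    HasGradientAt (tiltedLoss f x t) ((1 / (N : ℝ)) • ∑ i, stochGrad f x t i θ) θ := by
  have hexp : Real.exp (t * tiltedLoss f x t θ)
      = 1 / (N : ℝ) * ∑ i, Real.exp (t * f (x i) θ) := by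
    rw [exp_mul_tiltedLoss ht, Fintype.expect_eq_sum_div_card, Fintype.card_fin]; ring
  have hne : 1 / (N : ℝ) * ∑ i, Real.exp (t * f (x i) θ) ≠ 0 := hexp ▸ (Real.exp_pos _).ne'
  have hsummand : ∀ i, HasFDerivAt (fun θ => Real.exp (t * f (x i) θ)) _ θ := fun i =>
    ((hdiff i).hasGradientAt.hasFDerivAt.const_mul t).exp
  have hlog := (((HasFDerivAt.fun_sum (u := Finset.univ) fun i _ => hsummand i).const_mul
    (1 / (N : ℝ))).log hne).const_mul (1 / t)
  have hunfold : tiltedLoss f x t = fun θ =>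
      1 / t * Real.log (1 / (N : ℝ) * ∑ i, Real.exp (t * f (x i) θ)) := by
    funext θ
    rw [tiltedLoss, tiltedLossOn, Finset.card_univ, Fintype.card_fin]
  rw [hasGradientAt_iff_hasFDerivAt, hunfold]
  refine hlog.congr_fderiv ?_
  rw [← hexp]
  simp only [stochGrad, map_smul, map_sum, Finset.smul_sum, smul_smul]
  refine Finset.sum_congr rfl fun i _ => ?_
  congr 1
  field_simp

theorem gradient_tiltedLoss (ht : t ≠ 0) (hdiff : ∀ i, DifferentiableAt ℝ (f (x i)) θ) :
    gradient (tiltedLoss f x t) θ = (1 / (N : ℝ)) • ∑ i, stochGrad f x t i θ :=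
  (hasGradientAt_tiltedLoss ht hdiff).gradient

theorem differentiable_tiltedLoss (ht : t ≠ 0) (hdiff : ∀ i, Differentiable ℝ (f (x i))) :
    Differentiable ℝ (tiltedLoss f x t) :=
  fun _ => (hasGradientAt_tiltedLoss ht fun i => hdiff i _).differentiableAt

theorem expect_inner_stochGrad (ht : t ≠ 0) (hdiff : ∀ i, DifferentiableAt ℝ (f (x i)) θ) :
    𝔼 i, inner ℝ (gradient (tiltedLoss f x t) θ) (stochGrad f x t i θ)
      = ‖gradient (tiltedLoss f x t) θ‖ ^ 2 := by
  rw [← real_inner_self_eq_norm_sq]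
  nth_rw 3 [gradient_tiltedLoss ht hdiff]
  rw [Fintype.expect_eq_sum_div_card, Fintype.card_fin, real_inner_smul_right, inner_sum]
  ring

theorem norm_gradient_tiltedLoss_le (ht : t ≠ 0) (hdiff : ∀ i, DifferentiableAt ℝ (f (x i)) θ)
    (hgrad : ∀ i, ‖stochGrad f x t i θ‖ ≤ B) : ‖gradient (tiltedLoss f x t) θ‖ ≤ B := by
  rw [gradient_tiltedLoss ht hdiff, norm_smul, Real.norm_of_nonneg (by positivity)]
  calc 1 / (N : ℝ) * ‖∑ i, stochGrad f x t i θ‖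
      ≤ 1 / (N : ℝ) * ∑ _i : Fin N, B := by gcongr; exact norm_sum_le_of_le _ fun i _ => hgrad i
    _ = B := by
        have hN : (N : ℝ) ≠ 0 := NeZero.ne _
        simp [hN]

theorem norm_gradient_tiltedLoss_le_sqrt {β : ℝ≥0} (ht : 0 < t) (hβ : 0 < β)
    (hbdd : ∀ i θ, f (x i) θ ∈ Set.Icc Fmin Fmax) (hdiff : ∀ i, Differentiable ℝ (f (x i)))
    (hsmooth : LipschitzWith β (gradient (tiltedLoss f x t))) (θ : Param d) :
    ‖gradient (tiltedLoss f x t) θ‖ ≤ √(2 * β * (Fmax - Fmin)) :=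
  Real.le_sqrt_of_sq_le (norm_gradient_sq_le_of_mem_Icc (differentiable_tiltedLoss ht.ne' hdiff)
    hsmooth hβ (fun θ => tiltedLoss_mem_Icc ht fun i => hbdd i θ) θ)

theorem expect_exp_estimateUpdate (ht : t ≠ 0) (h0 : 0 ≤ lam) (h1 : lam ≤ 1) :
    𝔼 j, Real.exp (t * (estimateUpdate f x t lam {j} θ ρ - tiltedLoss f x t θ))
      = (1 - lam) * Real.exp (t * (ρ - tiltedLoss f x t θ)) + lam := by
  simp only [mul_sub, Real.exp_sub, exp_mul_estimateUpdate ht h0 h1, tiltedLossOn_singleton ht]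
  rw [← Finset.expect_div, Finset.expect_add_distrib, Fintype.expect_const,
    ← Finset.mul_expect, ← exp_mul_tiltedLoss ht]
  field_simp

theorem norm_gradient_tiltedLoss_sq_le {β : ℝ≥0} (ht : 0 < t) (hB : 0 ≤ B) (hβ : 0 < β)
    (hbdd : ∀ i θ, f (x i) θ ∈ Set.Icc Fmin Fmax) (hdiff : ∀ i, Differentiable ℝ (f (x i)))
    (hsmooth : LipschitzWith β (gradient (tiltedLoss f x t)))
    (hgrad : ∀ i θ, ‖stochGrad f x t i θ‖ ≤ B) (θ : Param d) :
    ‖gradient (tiltedLoss f x t) θ‖ ^ 2 ≤ B * √(2 * β * (Fmax - Fmin)) := by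
  rw [sq]
  gcongr
  · exact norm_gradient_tiltedLoss_le ht.ne' (fun i => hdiff i θ) fun i => hgrad i θ
  · exact norm_gradient_tiltedLoss_le_sqrt ht hβ hbdd hdiff hsmooth θ

end TiltedLoss

section Iteration

variable {𝒳 : Type*} {N d : ℕ} {f : 𝒳 → Param d → ℝ} {x : Fin N → 𝒳} {s : Param d × ℝ}
  {t α lam B Fmin Fmax : ℝ} {β : ℝ≥0}

theorem averagingWeight_nonneg : 0 ≤ averagingWeight := by
  have hexp := Real.add_one_le_exp 1
  rw [averagingWeight, sub_nonneg, div_le_one (by positivity)]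
  linarith

theorem averagingWeight_le_one : averagingWeight ≤ 1 :=
  sub_le_self 1 (by positivity)

theorem expect_potential_iteration_le [NeZero N] (ht : 0 < t) (hα : 0 ≤ α) (hβ : 0 < β)
    (hlam : averagingWeight ≤ lam) (hlam1 : lam ≤ 1)
    (hbdd : ∀ i θ, f (x i) θ ∈ Set.Icc Fmin Fmax) (hdiff : ∀ i, Differentiable ℝ (f (x i)))
    (hsmooth : LipschitzWith β (gradient (tiltedLoss f x t)))
    (hgrad : ∀ i θ, ‖stochGrad f x t i θ‖ ≤ B) (hs : s.2 ∈ Set.Icc Fmin Fmax)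
    (hstep : t * (√(2 * β * (Fmax - Fmin)) * (α * B * Real.exp (t * (Fmax - Fmin)))) ≤ 1) :
    𝔼 c : Fin N × Fin N, potential (tiltedLoss f x t) t α (iteration f x t lam α {c.1} {c.2} s)
      ≤ potential (tiltedLoss f x t) t α s - α / 2 * ‖gradient (tiltedLoss f x t) s.1‖ ^ 2
        + β * (α * B * Real.exp (t * (Fmax - Fmin))) ^ 2 := by
  have hR := differentiable_tiltedLoss ht.ne' hdiff
  have hmem : ∀ θ, tiltedLoss f x t θ ∈ Set.Icc Fmin Fmax := fun θ =>
    tiltedLoss_mem_Icc ht fun i => hbdd i θ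
  have hlam0 : 0 ≤ lam := averagingWeight_nonneg.trans hlam
  have hgap : ∀ j, tiltedLoss f x t s.1 - estimateUpdate f x t lam {j} s.1 s.2 ≤ Fmax - Fmin :=
    fun j => sub_le_sub (hmem s.1).2 (estimateUpdate_mem_Icc ht hlam0 hlam1
      (tiltedLossOn_mem_Icc ht (Finset.singleton_nonempty j) fun i _ => hbdd i s.1) hs).1
  rw [← Finset.univ_product_univ, Finset.expect_product, Finset.expect_comm]
  simp only [iteration, paramUpdate_singleton]
  refine expect_expect_potential_step_le hR hsmooth
    (fun θ => norm_gradient_tiltedLoss_le ht.ne' (fun i => hdiff i θ) fun i => hgrad i θ)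
    ht.le hα (fun i => hgrad i s.1) (expect_inner_stochGrad ht.ne' fun i => hdiff i s.1) hlam
    hlam1 (expect_exp_estimateUpdate ht.ne' hlam0 hlam1)
    (sub_nonneg.2 ((hmem s.1).1.trans (hmem s.1).2)) hgap fun i j => le_trans ?_ hstep
  gcongr
  refine (sub_le_mul_norm_sub_of_norm_gradient_le hR
    (norm_gradient_tiltedLoss_le_sqrt ht hβ hbdd hdiff hsmooth) _ _).trans ?_
  rw [sub_sub_cancel, norm_smul, Real.norm_of_nonneg (by positivity)]
  calc _ ≤ √(2 * β * (Fmax - Fmin)) * (α * Real.exp (t * (Fmax - Fmin)) * B) := by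
        gcongr √(2 * β * (Fmax - Fmin)) * (α * Real.exp (t * ?_) * ?_)
        exacts [hgap j, hgrad i s.1]
    _ = _ := by ring

end Iteration

section Recursion

theorem exists_eq_comp_of_recursion {Ω A C : Type*} {S : ℕ → Ω → A} {W : ℕ → Ω → C}
    {F : ℕ → C → A → A} {s₀ : A} (h0 : ∀ ω, S 0 ω = s₀)
    (hsucc : ∀ n ω, S (n + 1) ω = F n (W (n + 1) ω) (S n ω)) (n : ℕ) :
    ∃ ψ : (Finset.Iic n → C) → A, ∀ ω, S n ω = ψ fun k => W k ω := by
  induction n with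
  | zero => exact ⟨fun _ => s₀, h0⟩
  | succ n ih =>
    obtain ⟨ψ, hψ⟩ := ih
    refine ⟨fun w => F n (w ⟨n + 1, Finset.mem_Iic.2 le_rfl⟩) (ψ fun k => w ⟨k, ?_⟩), fun ω => ?_⟩
    · exact Finset.mem_Iic.2 ((Finset.mem_Iic.1 k.2).trans n.le_succ)
    · rw [hsucc, hψ]

variable {Ω : Type*} [MeasurableSpace Ω] {μ : Measure Ω} {A C : Type*}
  [MeasurableSpace C] [MeasurableSingletonClass C]

theorem integral_comp_eq_integral_expect [Fintype C] [IsFiniteMeasure μ] [MeasurableSpace A]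
    {X : Ω → A} {Y : Ω → C} (hX : Measurable X) (hY : Measurable Y) (hXY : IndepFun X Y μ)
    (hunif : ∀ c, μ {ω | Y ω = c} = (Fintype.card C : ℝ≥0∞)⁻¹) {φ : A × C → ℝ}
    (hφ : Integrable φ ((μ.map X).prod (μ.map Y))) :
    ∫ ω, φ (X ω, Y ω) ∂μ = ∫ ω, 𝔼 c, φ (X ω, c) ∂μ := by
  have hmap := (indepFun_iff_map_prod_eq_prod_map_map hX.aemeasurable hY.aemeasurable).1 hXY
  have : IsFiniteMeasure (μ.map Y) := Measure.isFiniteMeasure_map μ Y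
  have huniform : ∀ a, ∫ c, φ (a, c) ∂μ.map Y = 𝔼 c, φ (a, c) := fun a => by
    have hreal : ∀ c, (μ.map Y).real {c} = (Fintype.card C : ℝ)⁻¹ := fun c => by
      rw [map_measureReal_apply hY (measurableSet_singleton c), measureReal_def]
      exact (congrArg ENNReal.toReal (hunif c)).trans (by simp)
    rw [integral_fintype .of_finite, Fintype.expect_eq_sum_div_card, Finset.sum_div]
    simp only [hreal, smul_eq_mul, div_eq_inv_mul]
  calc ∫ ω, φ (X ω, Y ω) ∂μ
      = ∫ p, φ p ∂(μ.map X).prod (μ.map Y) := by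
        rw [← hmap, integral_map (hX.prodMk hY).aemeasurable (hmap ▸ hφ.aestronglyMeasurable)]
    _ = ∫ a, ∫ c, φ (a, c) ∂μ.map Y ∂μ.map X := integral_prod φ hφ
    _ = ∫ ω, ∫ c, φ (X ω, c) ∂μ.map Y ∂μ :=
        integral_map hX.aemeasurable hφ.integral_prod_left.aestronglyMeasurable
    _ = ∫ ω, 𝔼 c, φ (X ω, c) ∂μ := by simp only [huniform]

variable {S : ℕ → Ω → A} {W : ℕ → Ω → C} {F : ℕ → C → A → A} {s₀ : A}

theorem integrable_comp_of_recursion [Finite C] [IsFiniteMeasure μ] (hW : ∀ n, Measurable (W n))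
    (h0 : ∀ ω, S 0 ω = s₀)
    (hsucc : ∀ n ω, S (n + 1) ω = F n (W (n + 1) ω) (S n ω)) (Φ : A → ℝ) (n : ℕ) :
    Integrable (fun ω => Φ (S n ω)) μ := by
  obtain ⟨ψ, hψ⟩ := exists_eq_comp_of_recursion h0 hsucc n
  have hpast : Measurable fun ω (k : Finset.Iic n) => W k ω := measurable_pi_lambda _ fun k => hW k
  have : IsFiniteMeasure (μ.map fun ω (k : Finset.Iic n) => W k ω) :=
    Measure.isFiniteMeasure_map μ _
  simp only [hψ]
  exact (Integrable.of_finite (f := Φ ∘ ψ)).comp_measurable hpast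

theorem integral_recursion_succ [Fintype C] [IsFiniteMeasure μ] (hW : ∀ n, Measurable (W n))
    (h0 : ∀ ω, S 0 ω = s₀)
    (hsucc : ∀ n ω, S (n + 1) ω = F n (W (n + 1) ω) (S n ω))
    (hindep : ∀ n, IndepFun (fun ω (k : Finset.Iic n) => W k ω) (W (n + 1)) μ)
    (hunif : ∀ n c, μ {ω | W n ω = c} = (Fintype.card C : ℝ≥0∞)⁻¹) (Φ : A → ℝ) (n : ℕ) :
    ∫ ω, Φ (S (n + 1) ω) ∂μ = ∫ ω, 𝔼 c, Φ (F n c (S n ω)) ∂μ := by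
  obtain ⟨ψ, hψ⟩ := exists_eq_comp_of_recursion h0 hsucc n
  have hpast : Measurable fun ω (k : Finset.Iic n) => W k ω := measurable_pi_lambda _ fun k => hW k
  have : IsFiniteMeasure (μ.map fun ω (k : Finset.Iic n) => W k ω) :=
    Measure.isFiniteMeasure_map μ _
  have : IsFiniteMeasure (μ.map (W (n + 1))) := Measure.isFiniteMeasure_map μ _
  simp only [hsucc, hψ]
  exact integral_comp_eq_integral_expect hpast (hW (n + 1)) (hindep n) (hunif (n + 1))
    (φ := fun p => Φ (F n p.2 (ψ p.1))) .of_finite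

theorem sum_integral_le_of_expect_le [Fintype C] [IsProbabilityMeasure μ]
    (hW : ∀ n, Measurable (W n)) (h0 : ∀ ω, S 0 ω = s₀)
    (hsucc : ∀ n ω, S (n + 1) ω = F n (W (n + 1) ω) (S n ω))
    (hindep : ∀ n, IndepFun (fun ω (k : Finset.Iic n) => W k ω) (W (n + 1)) μ)
    (hunif : ∀ n c, μ {ω | W n ω = c} = (Fintype.card C : ℝ≥0∞)⁻¹) {Φ G : A → ℝ} {ε : ℝ} {m n : ℕ}
    (hmn : m ≤ n)
    (hdrift : ∀ k, m ≤ k → ∀ ω, 𝔼 c, Φ (F k c (S k ω)) ≤ Φ (S k ω) - G (S k ω) + ε) :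
    ∑ k ∈ Finset.Ico m n, ∫ ω, G (S k ω) ∂μ
      ≤ ∫ ω, Φ (S m ω) ∂μ - ∫ ω, Φ (S n ω) ∂μ + (n - m) * ε := by
  have hint : ∀ (Ψ : A → ℝ) k, Integrable (fun ω => Ψ (S k ω)) μ :=
    integrable_comp_of_recursion hW h0 hsucc
  have hdecrease : ∀ k, m ≤ k →
      ∫ ω, G (S k ω) ∂μ ≤ ∫ ω, Φ (S k ω) ∂μ - ∫ ω, Φ (S (k + 1) ω) ∂μ + ε := fun k hk => by
    have hmono := integral_mono (hint (fun s => 𝔼 c, Φ (F k c s)) k)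
      (hint (fun s => Φ s - G s + ε) k) (hdrift k hk)
    rw [← integral_recursion_succ hW h0 hsucc hindep hunif,
      integral_add (hint (fun s => Φ s - G s) k) (integrable_const ε),
      integral_sub (hint Φ k) (hint G k), integral_const, probReal_univ, one_smul] at hmono
    linarith
  induction n, hmn using Nat.le_induction with
  | base => simp
  | succ n hmn ih =>
    rw [Finset.sum_Ico_succ_top hmn]
    push_cast
    linarith [hdecrease n hmn]

end Recursion

section PairedSamples

variable {Ω : Type*} [MeasurableSpace Ω] {μ : Measure Ω}

theorem measure_prodMk_eq_inv_card {A B : Type*} [Fintype A] [MeasurableSpace A]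
    [MeasurableSingletonClass A] [Fintype B] [MeasurableSpace B] [MeasurableSingletonClass B]
    {X : Ω → A} {Y : Ω → B} (hXY : IndepFun X Y μ)
    (hX : ∀ a, μ {ω | X ω = a} = (Fintype.card A : ℝ≥0∞)⁻¹)
    (hY : ∀ b, μ {ω | Y ω = b} = (Fintype.card B : ℝ≥0∞)⁻¹) (c : A × B) :
    μ {ω | (X ω, Y ω) = c} = (Fintype.card (A × B) : ℝ≥0∞)⁻¹ := by
  have hinter : {ω | (X ω, Y ω) = c} = X ⁻¹' {c.1} ∩ Y ⁻¹' {c.2} := by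
    ext ω
    simp [Prod.ext_iff]
  rw [hinter, hXY.measure_inter_preimage_eq_mul _ _ (measurableSet_singleton _)
    (measurableSet_singleton _), Fintype.card_prod, Nat.cast_mul,
    ENNReal.mul_inv (.inr (ENNReal.natCast_ne_top _)) (.inl (ENNReal.natCast_ne_top _))]
  exact congrArg₂ (· * ·) (hX c.1) (hY c.2)

theorem indepFun_pi_prodMk_of_notMem {ι C : Type*} [MeasurableSpace C] {ζ ξ : ι → Ω → C}
    (hζ : ∀ i, Measurable (ζ i)) (hξ : ∀ i, Measurable (ξ i))
    (hindep : iIndepFun (Sum.elim ζ ξ) μ) {s : Finset ι} {j : ι} (hj : j ∉ s) :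
    IndepFun (fun ω (i : s) => (ζ i ω, ξ i ω)) (fun ω => (ζ j ω, ξ j ω)) μ := by
  have hmeas : ∀ i, Measurable (Sum.elim ζ ξ i) := Sum.rec hζ hξ
  have hdisj : Disjoint (s.disjSum s) (({j} : Finset ι).disjSum {j}) := by
    rw [Finset.disjoint_left]
    rintro (i | i) hi hij <;> simp_all
  have hpast : Measurable fun (w : s.disjSum s → C) (i : s) =>
      (w ⟨.inl i, Finset.inl_mem_disjSum.2 i.2⟩, w ⟨.inr i, Finset.inr_mem_disjSum.2 i.2⟩) := by
    fun_prop
  have hpresent : Measurable fun w : ({j} : Finset ι).disjSum {j} → C =>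
      (w ⟨.inl j, by simp⟩, w ⟨.inr j, by simp⟩) := by
    fun_prop
  exact (hindep.indepFun_finset _ _ hdisj hmeas).comp hpast hpresent

end PairedSamples

section Solver

variable {𝒳 : Type*} {N d : ℕ} {f : 𝒳 → Param d → ℝ} {x : Fin N → 𝒳}
  {t lam a B C Fmin Fmax : ℝ} {β : ℝ≥0} {α : ℕ → ℝ} {θ₁ : Param d} {m n : ℕ}

theorem state_snd_mem_Icc [NeZero N] {B₁ B₂ : ℕ → Finset (Fin N)} (ht : 0 < t) (h0 : 0 ≤ lam)
    (h1 : lam ≤ 1) (hB₂ : ∀ k, (B₂ k).Nonempty) (hbdd : ∀ i θ, f (x i) θ ∈ Set.Icc Fmin Fmax)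
    (n : ℕ) : (state f x t lam α B₁ B₂ θ₁ n).2 ∈ Set.Icc Fmin Fmax := by
  induction n with
  | zero => exact tiltedLoss_mem_Icc ht fun i => hbdd i θ₁
  | succ n ih =>
    exact estimateUpdate_mem_Icc ht h0 h1 (tiltedLossOn_mem_Icc ht (hB₂ _) fun i _ => hbdd i _) ih

variable {Ω : Type*} [MeasurableSpace Ω] {μ : Measure Ω} {ζ ξ : ℕ → Ω → Fin N}

theorem integrable_comp_state [IsFiniteMeasure μ] (hζ : ∀ k, Measurable (ζ k))
    (hξ : ∀ k, Measurable (ξ k)) (Φ : Param d × ℝ → ℝ) (n : ℕ) :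
    Integrable (fun ω => Φ (state f x t lam α (fun j => {ζ j ω}) (fun j => {ξ j ω}) θ₁ n)) μ :=
  integrable_comp_of_recursion
    (S := fun n ω => state f x t lam α (fun j => {ζ j ω}) (fun j => {ξ j ω}) θ₁ n)
    (W := fun k ω => (ζ k ω, ξ k ω))
    (F := fun n c s => iteration f x t lam (α (n + 1)) {c.1} {c.2} s)
    (fun k => (hζ k).prodMk (hξ k)) (fun _ => rfl) (fun _ _ => rfl) Φ n

theorem integral_norm_gradient_sq_state_le [IsProbabilityMeasure μ]
    (hζ : ∀ k, Measurable (ζ k)) (hξ : ∀ k, Measurable (ξ k))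
    (hC : ∀ θ, ‖gradient (tiltedLoss f x t) θ‖ ^ 2 ≤ C) (n : ℕ) :
    ∫ ω, ‖gradient (tiltedLoss f x t)
      (state f x t lam α (fun j => {ζ j ω}) (fun j => {ξ j ω}) θ₁ n).1‖ ^ 2 ∂μ ≤ C := by
  simpa using integral_mono (μ := μ)
    (integrable_comp_state hζ hξ (fun s => ‖gradient (tiltedLoss f x t) s.1‖ ^ 2) n)
    (integrable_const C) fun _ => hC _

theorem sum_integral_state_le [IsProbabilityMeasure μ] (hζ : ∀ k, Measurable (ζ k))
    (hξ : ∀ k, Measurable (ξ k))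
    (hζ_unif : ∀ k i, μ {ω | ζ k ω = i} = (N : ℝ≥0∞)⁻¹)
    (hξ_unif : ∀ k i, μ {ω | ξ k ω = i} = (N : ℝ≥0∞)⁻¹) (hindep : iIndepFun (Sum.elim ζ ξ) μ)
    {Φ G : Param d × ℝ → ℝ} {ε : ℝ} (hmn : m ≤ n)
    (hdrift : ∀ k, m ≤ k → ∀ ω,
      let s := state f x t lam α (fun j => {ζ j ω}) (fun j => {ξ j ω}) θ₁ k
      𝔼 c : Fin N × Fin N, Φ (iteration f x t lam (α (k + 1)) {c.1} {c.2} s) ≤ Φ s - G s + ε) :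
    ∑ k ∈ Finset.Ico m n,
        ∫ ω, G (state f x t lam α (fun j => {ζ j ω}) (fun j => {ξ j ω}) θ₁ k) ∂μ
      ≤ ∫ ω, Φ (state f x t lam α (fun j => {ζ j ω}) (fun j => {ξ j ω}) θ₁ m) ∂μ
        - ∫ ω, Φ (state f x t lam α (fun j => {ζ j ω}) (fun j => {ξ j ω}) θ₁ n) ∂μ
        + (n - m) * ε :=
  sum_integral_le_of_expect_le (W := fun k ω => (ζ k ω, ξ k ω))
    (F := fun n c s => iteration f x t lam (α (n + 1)) {c.1} {c.2} s)
    (fun k => (hζ k).prodMk (hξ k)) (fun _ => rfl) (fun _ _ => rfl)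
    (fun _ => indepFun_pi_prodMk_of_notMem hζ hξ hindep (by simp))
    (fun k => measure_prodMk_eq_inv_card (hindep.indepFun (i := .inl k) (j := .inr k) (by simp))
      (by simpa using hζ_unif k) (by simpa using hξ_unif k))
    hmn hdrift

theorem sum_integral_norm_gradient_sq_state_le [NeZero N] [IsProbabilityMeasure μ] (ht : 0 < t)
    (ha : 0 ≤ a) (hβ : 0 < β) (hlam : averagingWeight ≤ lam) (hlam1 : lam ≤ 1)
    (hbdd : ∀ i θ, f (x i) θ ∈ Set.Icc Fmin Fmax) (hdiff : ∀ i, Differentiable ℝ (f (x i)))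
    (hsmooth : LipschitzWith β (gradient (tiltedLoss f x t)))
    (hgrad : ∀ i θ, ‖stochGrad f x t i θ‖ ≤ B)
    (hC : ∀ θ, ‖gradient (tiltedLoss f x t) θ‖ ^ 2 ≤ C)
    (hζ : ∀ k, Measurable (ζ k)) (hξ : ∀ k, Measurable (ξ k))
    (hζ_unif : ∀ k i, μ {ω | ζ k ω = i} = (N : ℝ≥0∞)⁻¹)
    (hξ_unif : ∀ k i, μ {ω | ξ k ω = i} = (N : ℝ≥0∞)⁻¹) (hindep : iIndepFun (Sum.elim ζ ξ) μ)
    (hmn : m ≤ n) (hα : ∀ k, m ≤ k → α (k + 1) = a)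
    (hstep : t * (√(2 * β * (Fmax - Fmin)) * (a * B * Real.exp (t * (Fmax - Fmin)))) ≤ 1) :
    a / 2 * ∑ k ∈ Finset.Ico m n, ∫ ω, ‖gradient (tiltedLoss f x t)
        (state f x t lam α (fun j => {ζ j ω}) (fun j => {ξ j ω}) θ₁ k).1‖ ^ 2 ∂μ
      ≤ Fmax - Fmin + a / (4 * Real.exp 1) * (Real.exp (t * (Fmax - Fmin)) * C)
        + (n - m) * (β * (a * B * Real.exp (t * (Fmax - Fmin))) ^ 2) := by
  have hlam0 : 0 ≤ lam := averagingWeight_nonneg.trans hlam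
  have hestimate : ∀ k ω, (state f x t lam α (fun j => {ζ j ω}) (fun j => {ξ j ω}) θ₁ k).2
      ∈ Set.Icc Fmin Fmax := fun k ω =>
    state_snd_mem_Icc ht hlam0 hlam1 (fun _ => Finset.singleton_nonempty _) hbdd k
  have hmem : ∀ θ, tiltedLoss f x t θ ∈ Set.Icc Fmin Fmax := fun θ =>
    tiltedLoss_mem_Icc ht fun i => hbdd i θ
  have hpotential := integrable_comp_state (μ := μ) (f := f) (x := x) (t := t) (lam := lam) (α := α)
    (θ₁ := θ₁) hζ hξ (potential (tiltedLoss f x t) t a)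
  have htelescope := sum_integral_state_le (f := f) (x := x) (t := t) (lam := lam) (α := α)
    (θ₁ := θ₁) (ε := β * (a * B * Real.exp (t * (Fmax - Fmin))) ^ 2) hζ hξ hζ_unif hξ_unif hindep
    (Φ := potential (tiltedLoss f x t) t a)
    (G := fun s => a / 2 * ‖gradient (tiltedLoss f x t) s.1‖ ^ 2) hmn fun k hk ω => by
      simp only [hα k hk]
      exact expect_potential_iteration_le ht ha hβ hlam hlam1 hbdd hdiff hsmooth hgrad
        (hestimate k ω) hstep
  have hstart := integral_mono (hpotential m) (integrable_const _) fun ω =>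
    potential_le ht.le ha (hmem _).2 (sub_le_sub (hestimate m ω).2 (hmem _).1) (hC _)
  have hend := integral_mono (integrable_const Fmin) (hpotential n) fun ω =>
    (hmem _).1.trans (le_potential ha _)
  simp only [integral_const_mul, ← Finset.mul_sum] at htelescope
  simp only [integral_const, probReal_univ, one_smul] at hstart hend
  linarith

end Solver

section BalancedStep

variable {t B β Δ K : ℝ}

/-- The constant step size for the horizon `K` that balances, in the telescoped descent
inequality, the range `Δ` of the objective against the accumulated smoothness error. -/
noncomputable def balancedStep (t β B Δ K : ℝ) : ℝ :=
  √(2 * Δ) / (Real.exp (t * Δ) * √(β * B ^ 2 * K))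

theorem balancedStep_nonneg : 0 ≤ balancedStep t β B Δ K := by
  unfold balancedStep
  positivity

theorem balancedStep_mul (hB : 0 < B) (hΔ : 0 ≤ Δ) :
    balancedStep t β B Δ K * B * Real.exp (t * Δ) = √(2 * Δ / (β * K)) := by
  have hroot : √(β * B ^ 2 * K) = B * √(β * K) := by
    rw [mul_right_comm, mul_comm, Real.sqrt_mul (sq_nonneg B), Real.sqrt_sq hB.le]
  rw [balancedStep, hroot, Real.sqrt_div (by positivity)]
  field_simp

theorem sqrt_mul_balancedStep (hβ : 0 < β) (hB : 0 < B) (hΔ : 0 ≤ Δ) :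
    √(2 * β * Δ) * (balancedStep t β B Δ K * B * Real.exp (t * Δ)) = 2 * Δ / √K := by
  rw [balancedStep_mul hB hΔ, ← Real.sqrt_mul (by positivity),
    show 2 * β * Δ * (2 * Δ / (β * K)) = (2 * Δ) ^ 2 / K by field_simp,
    Real.sqrt_div (by positivity), Real.sqrt_sq (by positivity)]

theorem mul_sq_balancedStep (hβ : 0 < β) (hB : 0 < B) (hΔ : 0 ≤ Δ) (hK : 0 < K) :
    K * (β * (balancedStep t β B Δ K * B * Real.exp (t * Δ)) ^ 2) = 2 * Δ := by
  rw [balancedStep_mul hB hΔ, Real.sq_sqrt (by positivity)]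
  field_simp

theorem balancedStep_mul_rate (hβ : 0 < β) (hB : 0 < B) (hΔ : 0 ≤ Δ) (hK : 0 < K) :
    balancedStep t β B Δ K * (K * (√8 * B * Real.exp (t * Δ + 1) * √(β * Δ / K)))
      = 4 * Real.exp 1 * Δ := by
  calc _ = Real.exp 1 * K
          * (balancedStep t β B Δ K * B * Real.exp (t * Δ) * √8 * √(β * Δ / K)) := by
        rw [Real.exp_add]; ring
    _ = Real.exp 1 * K * √((4 * Δ / K) ^ 2) := by
        rw [balancedStep_mul hB hΔ, ← Real.sqrt_mul (by positivity),
          ← Real.sqrt_mul (by positivity)]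
        congr 2
        field_simp
        ring
    _ = 4 * Real.exp 1 * Δ := by rw [Real.sqrt_sq (by positivity)]; field_simp

theorem mul_sqrt_mul_balancedStep_le_one (hβ : 0 < β) (hB : 0 < B) (hΔ : 0 ≤ Δ)
    (hK : Real.exp (t * Δ + 1) ≤ √K) :
    t * (√(2 * β * Δ) * (balancedStep t β B Δ K * B * Real.exp (t * Δ))) ≤ 1 := by
  have hK0 : 0 < √K := (Real.exp_pos _).trans_le hK
  have hgrowth : 2 * (t * Δ) ≤ Real.exp (t * Δ + 1) := by
    calc 2 * (t * Δ) ≤ 2 * Real.exp (t * Δ) := by linarith [Real.add_one_le_exp (t * Δ)]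
      _ ≤ Real.exp (t * Δ) * Real.exp 1 := by
          rw [mul_comm]
          gcongr
          linarith [Real.add_one_le_exp 1]
      _ = Real.exp (t * Δ + 1) := (Real.exp_add _ _).symm
  rw [sqrt_mul_balancedStep hβ hB hΔ, mul_div_assoc', div_le_one hK0]
  linarith

theorem mean_le_of_balancedStep {S T : ℝ} (hβ : 0 < β) (hB : 0 < B) (ht : 0 ≤ t) (hΔ : 0 < Δ)
    (hK : 1 ≤ K) (hST : S ≤ B * √(2 * β * Δ) + T)
    (hT : balancedStep t β B Δ K / 2 * T ≤ Δ
      + balancedStep t β B Δ K / (4 * Real.exp 1) * (Real.exp (t * Δ) * (B * √(2 * β * Δ)))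
      + K * (β * (balancedStep t β B Δ K * B * Real.exp (t * Δ)) ^ 2)) :
    1 / K * S ≤ √8 * B * Real.exp (t * Δ + 1) * √(β * Δ / K) := by
  have hK0 : 0 < K := one_pos.trans_le hK
  have hpos : 0 < balancedStep t β B Δ K := by rw [balancedStep]; positivity
  have hinitial : balancedStep t β B Δ K * (Real.exp (t * Δ) * (B * √(2 * β * Δ))) ≤ 2 * Δ := by
    calc _ = √(2 * β * Δ) * (balancedStep t β B Δ K * B * Real.exp (t * Δ)) := by ring
      _ = 2 * Δ / √K := sqrt_mul_balancedStep hβ hB hΔ.le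
      _ ≤ 2 * Δ := div_le_self (by positivity) (Real.one_le_sqrt.2 hK)
  have hcorrection : balancedStep t β B Δ K / (4 * Real.exp 1)
      * (Real.exp (t * Δ) * (B * √(2 * β * Δ))) ≤ Δ / 2 := by
    rw [div_mul_eq_mul_div, div_le_iff₀ (by positivity)]
    nlinarith [Real.add_one_le_exp 1]
  have hextra : balancedStep t β B Δ K * (B * √(2 * β * Δ)) ≤ 2 * Δ := by
    refine (mul_le_mul_of_nonneg_left ?_ hpos.le).trans hinitial
    exact le_mul_of_one_le_left (by positivity) (Real.one_le_exp (by positivity))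
  rw [mul_sq_balancedStep hβ hB hΔ.le hK0] at hT
  rw [one_div, inv_mul_le_iff₀ hK0]
  refine le_of_mul_le_mul_left ?_ hpos
  rw [balancedStep_mul_rate hβ hB hΔ.le hK0]
  have hconstant : 9 * Δ ≤ 4 * Real.exp 1 * Δ := by
    gcongr
    linarith [Real.exp_one_gt_d9]
  linarith [mul_le_mul_of_nonneg_left hST hpos.le]

end BalancedStep

section Regimes

variable {t β B Δ K : ℝ}

theorem mean_le_of_sum_le {S : ℝ} (hB : 0 ≤ B) (hK : 1 ≤ K)
    (hsmall : √(β * Δ) ≤ Real.exp (t * Δ + 1) * √(β * Δ / K))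
    (hS : S ≤ (K + 1) * (B * √(2 * β * Δ))) :
    1 / K * S ≤ √8 * B * Real.exp (t * Δ + 1) * √(β * Δ / K) := by
  have hroot : 2 * √(2 * β * Δ) = √8 * √(β * Δ) := by
    rw [← Real.sqrt_mul (by positivity), show 8 * (β * Δ) = 2 ^ 2 * (2 * β * Δ) by ring,
      Real.sqrt_mul (sq_nonneg 2) (2 * β * Δ), Real.sqrt_sq zero_le_two]
  rw [one_div, inv_mul_le_iff₀ (one_pos.trans_le hK)]
  calc S ≤ (K + K) * (B * √(2 * β * Δ)) := hS.trans (by gcongr)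
    _ = K * (√8 * B * √(β * Δ)) := by linear_combination K * B * hroot
    _ ≤ K * (√8 * B * (Real.exp (t * Δ + 1) * √(β * Δ / K))) := by gcongr
    _ = _ := by ring

theorem pos_and_exp_le_sqrt_of_lt (hβ : 0 < β) (hΔ : 0 ≤ Δ) (hK : 0 < K)
    (hlarge : Real.exp (t * Δ + 1) * √(β * Δ / K) < √(β * Δ)) :
    0 < Δ ∧ Real.exp (t * Δ + 1) ≤ √K := by
  have hroot : 0 < √(β * Δ) := lt_of_le_of_lt (by positivity) hlarge
  refine ⟨pos_of_mul_pos_right (Real.sqrt_pos.1 hroot) hβ.le, ?_⟩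
  rw [Real.sqrt_div (by positivity), mul_div_assoc', div_lt_iff₀ (Real.sqrt_pos.2 hK),
    mul_comm, mul_lt_mul_iff_right₀ hroot] at hlarge
  exact hlarge.le

theorem mean_le_of_sum_le_of_balancedStep {S T : ℝ} (hβ : 0 < β) (hB : 0 < B) (ht : 0 ≤ t)
    (hΔ : 0 ≤ Δ) (hK : 1 ≤ K) (hST : S ≤ B * √(2 * β * Δ) + T)
    (hT : T ≤ K * (B * √(2 * β * Δ)))
    (hT_of_large : Real.exp (t * Δ + 1) ≤ √K → balancedStep t β B Δ K / 2 * T ≤ Δ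
      + balancedStep t β B Δ K / (4 * Real.exp 1) * (Real.exp (t * Δ) * (B * √(2 * β * Δ)))
      + K * (β * (balancedStep t β B Δ K * B * Real.exp (t * Δ)) ^ 2)) :
    1 / K * S ≤ √8 * B * Real.exp (t * Δ + 1) * √(β * Δ / K) := by
  rcases le_or_gt (√(β * Δ)) (Real.exp (t * Δ + 1) * √(β * Δ / K)) with hsmall | hlarge
  · exact mean_le_of_sum_le hB.le hK hsmall (by linarith)
  · obtain ⟨hΔ_pos, hexp⟩ := pos_and_exp_le_sqrt_of_lt hβ hΔ (one_pos.trans_le hK) hlarge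
    exact mean_le_of_balancedStep hβ hB ht hΔ_pos hK hST (hT_of_large hexp)

end Regimes

theorem sum_Icc_sub_one_le {g : ℕ → ℝ} (hg : 0 ≤ g 0) (m n : ℕ) :
    ∑ k ∈ Finset.Icc m n, g (k - 1) ≤ g 0 + ∑ k ∈ Finset.Ico (m - 1) n, g k := by
  rw [← Finset.Ico_add_one_right_eq_Icc]
  cases m with
  | zero =>
    rw [Finset.sum_eq_sum_Ico_succ_bot n.add_one_pos, ← Finset.sum_Ico_add' (fun k => g (k - 1))]
    simp
  | succ m =>
    rw [← Finset.sum_Ico_add' (fun k => g (k - 1))]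
    exact le_add_of_nonneg_left hg

end TERM

theorem mainTheorem10_general {𝒳 : Type*} {N d : ℕ}
    (f : 𝒳 → TERM.Param d → ℝ) (x : Fin N → 𝒳)
    (t lam B Fmin Fmax : ℝ) (β : ℝ≥0)
    (ht : 0 < t) (hB : 0 < B) (hβ : 0 < β)
    (hlam : TERM.averagingWeight ≤ lam) (hlam1 : lam ≤ 1)
    (hbdd : ∀ i θ, f (x i) θ ∈ Set.Icc Fmin Fmax)
    (hdiff : ∀ i, Differentiable ℝ (f (x i)))
    (hsmooth : LipschitzWith β (gradient (TERM.tiltedLoss f x t)))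
    (hgrad : ∀ i θ, ‖TERM.stochGrad f x t i θ‖ ≤ B)
    {Ω : Type*} [MeasurableSpace Ω] (μ : Measure Ω) [IsProbabilityMeasure μ]
    (ζ ξ : ℕ → Ω → Fin N)
    (hζ : ∀ k, Measurable (ζ k)) (hξ : ∀ k, Measurable (ξ k))
    (hζ_unif : ∀ k i, μ {ω | ζ k ω = i} = (N : ℝ≥0∞)⁻¹)
    (hξ_unif : ∀ k i, μ {ω | ξ k ω = i} = (N : ℝ≥0∞)⁻¹)
    (hindep : iIndepFun (Sum.elim ζ ξ) μ)
    (θ₁ : TERM.Param d) (α : ℕ → ℝ) (m K : ℕ) (hK1 : 1 ≤ K) (hK : m ≤ K)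
    (hα : ∀ k, m ≤ k → α k = TERM.balancedStep t β B (Fmax - Fmin) K) :
    (1 / (K : ℝ)) * ∑ k ∈ Finset.Icc m K,
        ∫ ω, ‖gradient (TERM.tiltedLoss f x t)
          (TERM.iterate f x t lam α (fun j => {ζ j ω}) (fun j => {ξ j ω}) θ₁ k)‖ ^ 2 ∂μ
      ≤ √8 * B * Real.exp (t * (Fmax - Fmin) + 1) * √(β * (Fmax - Fmin) / K) := by
  obtain ⟨ω₀⟩ := nonempty_of_isProbabilityMeasure μ
  have : NeZero N := .of_pos (ζ 0 ω₀).pos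
  have hΔ : 0 ≤ Fmax - Fmin := sub_nonneg.2 ((hbdd 0 θ₁).1.trans (hbdd 0 θ₁).2)
  have hC : ∀ θ, ‖gradient (TERM.tiltedLoss f x t) θ‖ ^ 2 ≤ B * √(2 * β * (Fmax - Fmin)) :=
    TERM.norm_gradient_tiltedLoss_sq_le ht hB.le hβ hbdd hdiff hsmooth hgrad
  let g : ℕ → ℝ := fun k => ∫ ω, ‖gradient (TERM.tiltedLoss f x t)
    (TERM.state f x t lam α (fun j => {ζ j ω}) (fun j => {ξ j ω}) θ₁ k).1‖ ^ 2 ∂μ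
  have hg : ∀ k, g k ≤ B * √(2 * β * (Fmax - Fmin)) :=
    TERM.integral_norm_gradient_sq_state_le hζ hξ hC
  have hshift : ∑ k ∈ Finset.Icc m K, g (k - 1)
      ≤ B * √(2 * β * (Fmax - Fmin)) + ∑ k ∈ Finset.Ico (m - 1) K, g k :=
    (TERM.sum_Icc_sub_one_le (integral_nonneg fun _ => sq_nonneg _) m K).trans
      (add_le_add_left (hg 0) _)
  have hcrude : ∑ k ∈ Finset.Ico (m - 1) K, g k ≤ K * (B * √(2 * β * (Fmax - Fmin))) := by
    refine (Finset.sum_le_card_nsmul _ _ _ fun k _ => hg k).trans ?_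
    rw [Nat.card_Ico, nsmul_eq_mul]
    gcongr
    exact Nat.sub_le K _
  refine TERM.mean_le_of_sum_le_of_balancedStep hβ hB ht.le hΔ (mod_cast hK1) hshift hcrude
    fun hlarge => (TERM.sum_integral_norm_gradient_sq_state_le ht TERM.balancedStep_nonneg hβ
      hlam hlam1 hbdd hdiff hsmooth hgrad hC hζ hξ hζ_unif hξ_unif hindep ((m.sub_le 1).trans hK)
      (fun k hk => hα _ (Nat.le_succ_of_pred_le hk))
      (TERM.mul_sqrt_mul_balancedStep_le_one hβ hB hΔ hlarge)).trans ?_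
  gcongr
  exact sub_le_self _ (Nat.cast_nonneg _)

theorem mainTheorem10 {𝒳 : Type*} {N d : ℕ}
    (f : 𝒳 → TERM.Param d → ℝ) (x : Fin N → 𝒳)
    (t B Fmin Fmax : ℝ) (L β : ℝ≥0)
    (ht : 0 < t) (hB : 0 < B) (hβ : 0 < β)
    (hbdd : ∀ z θ, Fmin ≤ f z θ ∧ f z θ ≤ Fmax)
    (hLip : ∀ z, LipschitzWith L (f z))
    (hdiff : ∀ i, Differentiable ℝ (f (x i)))
    (hsmooth : LipschitzWith β (gradient (TERM.tiltedLoss f x t)))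
    (hgrad : ∀ i θ, ‖TERM.stochGrad f x t i θ‖ ≤ B)
    {Ω : Type*} [MeasurableSpace Ω] (μ : Measure Ω) [IsProbabilityMeasure μ]
    (ζ ξ : ℕ → Ω → Fin N)
    (hζ : ∀ k, Measurable (ζ k)) (hξ : ∀ k, Measurable (ξ k))
    (hζ_unif : ∀ k i, μ {ω | ζ k ω = i} = (N : ℝ≥0∞)⁻¹)
    (hξ_unif : ∀ k i, μ {ω | ξ k ω = i} = (N : ℝ≥0∞)⁻¹)
    (hindep : iIndepFun (Sum.elim ζ ξ) μ)
    (θ₁ : TERM.Param d) (K : ℕ) (hK1 : 1 ≤ K)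
    (hK : TERM.burnIn t L β Fmin Fmax ≤ K) :
    (1 / (K : ℝ)) * ∑ k ∈ Finset.Icc (TERM.burnIn t L β Fmin Fmax) K,
        ∫ ω, ‖gradient (TERM.tiltedLoss f x t)
          (TERM.iterate f x t TERM.averagingWeight (TERM.stepSize t L β B Fmin Fmax K)
            (fun j => {ζ j ω}) (fun j => {ξ j ω}) θ₁ k)‖ ^ 2 ∂μ
      ≤ Real.sqrt 8 * B * Real.exp (t * (Fmax - Fmin) + 1)
          * Real.sqrt (β * (Fmax - Fmin) / K) := by
  exact mainTheorem10_general f x t TERM.averagingWeight B Fmin Fmax β ht hB hβ le_rfl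
    TERM.averagingWeight_le_one (fun i θ => hbdd (x i) θ) hdiff hsmooth hgrad μ ζ ξ hζ hξ
    hζ_unif hξ_unif hindep θ₁ _ _ K hK1 hK fun _ hk => if_neg hk.not_gt
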